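/- All graphs are finite and simple (undirected, without loops or parallel edges). For a graph $G$ let $\chi(G)$, $\omega(G)$ and $\Delta(G)$ denote its chromatic number, clique number and maximum degree. Say that Reed's Conjecture holds for $G$ if $\chi(G) \le \left\lceil \frac{\Delta(G)+\omega(G)+1}{2} \right\rceil$. A set of vertices is stable if its elements are pairwise non-adjacent, and an odd cycle is a cycle $C_n$ with $n \ge 3$ odd (so triangles are included). Let $\Delta_0 \in \mathbb{N}$. If Reed's Conjecture holds for all graphs of maximum degree at most $\Delta_0$, then it holds 1. for every graph in which the vertices of degree at least $\Delta_0+1$ form a stable set, and 2. for every graph $G$ in which every induced odd cycle contains a vertex whose degree in $G$ is at most $\Delta_0-1$. In particular (and without any hypothesis), if $G$ is a graph in which the vertices of degree at least $5$ form a stable set, or in which every induced odd cycle contains a vertex whose degree in $G$ is at most $3$, then Reed's Conjecture holds for $G$. -/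

import Mathlib

/-- The inequality of Reed's Conjecture for a single finite simple graph `G`:
`χ(G) ≤ ⌈(Δ(G) + ω(G) + 1) / 2⌉`, with `χ` the chromatic number, `Δ` the maximum degree
and `ω` the clique number. -/
def SatisfiesReed {V : Type*} [Fintype V] (G : SimpleGraph V) [DecidableRel G.Adj] : Prop :=
  G.chromaticNumber ≤ ((⌈((G.maxDegree : ℚ) + (G.cliqueNum : ℚ) + 1) / 2⌉₊ : ℕ) : ℕ∞)

universe u

/-! Deleting a set of vertices never increases ω. If the deleted set is `k`-colourable and Δ falls
by at least `2k`, Reed's bound falls by at least `k`, which pays for `k` fresh colours on the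
deleted set. Suppose Δ > Δ₀, since otherwise the hypothesis applies to the graph itself.

For the first claim, delete a maximal stable set containing all vertices of degree above Δ₀. Every
vertex left had degree at most Δ₀ and has lost a neighbour, so Δ falls to at most Δ₀ - 1, a drop of
at least 2.

For the second claim, the vertices of degree at least Δ₀ induce no odd cycle, hence a bipartite
graph (`exists_cycleGraph_embedding_of_not_colorable_two`). Enlarge its colour classes to disjoint
stable sets, the second maximal in the complement of the first. A vertex outside both had degree at
most Δ₀ - 1 and loses two neighbours, so Δ drops by at least 4 at the cost of two colours.

The unconditional statement is the case Δ₀ = 4, where Reed's inequality follows from greedy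
colouring and Brooks' theorem. The latter is proved by choosing colouring orders in which each
vertex has a neighbour still uncoloured, or two neighbours of the same colour. -/

namespace SimpleGraph

/-! ### Greedy colouring and Brooks' theorem -/

variable {V : Type*} {G : SimpleGraph V}

/-- `f` is a proper colouring of the vertices in `s`. -/
def ProperOn {α : Type*} (G : SimpleGraph V) (f : V → α) (s : Finset V) : Prop :=
  ∀ ⦃u⦄, u ∈ s → ∀ ⦃v⦄, v ∈ s → G.Adj u v → f u ≠ f v

theorem ProperOn.update_insert {α : Type*} [DecidableEq V] {f : V → α} {s : Finset V}
    (hf : G.ProperOn f s) {v : V} {c : α} (hc : ∀ u ∈ s, G.Adj v u → f u ≠ c) :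
    G.ProperOn (Function.update f v c) (insert v s) := by
  intro a ha b hb hab
  by_cases hav : a = v
  · subst hav
    have hba : b ≠ a := hab.ne'
    have hbs : b ∈ s := (Finset.mem_insert.mp hb).resolve_left hba
    rw [Function.update_self, Function.update_of_ne hba]
    exact (hc b hbs hab).symm
  · have has : a ∈ s := (Finset.mem_insert.mp ha).resolve_left hav
    by_cases hbv : b = v
    · subst hbv
      rw [Function.update_self, Function.update_of_ne hav]
      exact hc a has hab.symm
    · have hbs : b ∈ s := (Finset.mem_insert.mp hb).resolve_left hbv
      rw [Function.update_of_ne hav, Function.update_of_ne hbv]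
      exact hf has hbs hab

/-- Greedy extension of a partial colouring: it is enough that every nonempty set of uncoloured
vertices has a member which, when coloured last, sees fewer than `d` colours. -/
theorem ProperOn.exists_extend [Fintype V] [DecidableEq V] [DecidableRel G.Adj] {d : ℕ}
    {f : V → Fin d} {B : Finset V} (hf : G.ProperOn f B) (hdeg : ∀ v, G.degree v ≤ d)
    (D : Finset V)
    (h : ∀ U ⊆ D, U.Nonempty → ∃ v ∈ U, G.degree v < d ∨ (∃ w, G.Adj v w ∧ w ∉ B ∧ w ∉ U) ∨
      ∃ x ∈ B, ∃ y ∈ B, x ≠ y ∧ G.Adj v x ∧ G.Adj v y ∧ f x = f y) (hBD : Disjoint B D) :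
    ∃ g : V → Fin d, G.ProperOn g (B ∪ D) ∧ ∀ v ∈ B, g v = f v := by
  induction D using Finset.strongInduction with
  | H D ih =>
    rcases D.eq_empty_or_nonempty with rfl | hD
    · exact ⟨f, by simpa using hf, fun _ _ => rfl⟩
    obtain ⟨v, hvD, hv⟩ := h D subset_rfl hD
    obtain ⟨g, hg, hgf⟩ := ih (D.erase v) (Finset.erase_ssubset hvD)
      (fun U hU => h U (hU.trans (Finset.erase_subset _ _)))
      (hBD.mono_right (Finset.erase_subset _ _))
    have hvB : v ∉ B := fun hvB => Finset.disjoint_left.mp hBD hvB hvD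
    -- `v` is coloured after the rest of `D`. It sees fewer than `d` colours because it has fewer
    -- than `d` neighbours, or one is still uncoloured, or two share a colour.
    have key : ((G.neighborFinset v ∩ (B ∪ D.erase v)).image g).card < d := by
      rcases hv with hv | ⟨w, hvw, hwB, hwD⟩ | ⟨x, hx, y, hy, hxy, hvx, hvy, hfxy⟩
      · refine lt_of_le_of_lt (Finset.card_image_le.trans ?_) hv
        exact Finset.card_le_card Finset.inter_subset_left
      · refine lt_of_lt_of_le (lt_of_le_of_lt Finset.card_image_le ?_) (hdeg v)
        refine Finset.card_lt_card ⟨Finset.inter_subset_left, fun hsub => ?_⟩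
        have := hsub ((G.mem_neighborFinset v w).mpr hvw)
        simp [hwB, hwD] at this
      · have hsub : (G.neighborFinset v ∩ (B ∪ D.erase v)).image g ⊆
            ((G.neighborFinset v).erase x).image g := by
          intro c hc
          obtain ⟨z, hz, rfl⟩ := Finset.mem_image.mp hc
          by_cases hzx : z = x
          · refine Finset.mem_image.mpr ⟨y, ?_, ?_⟩
            · simp [hxy.symm, hvy]
            · rw [hzx, hgf x hx, hgf y hy, hfxy]
          · exact Finset.mem_image_of_mem _
              (Finset.mem_erase.mpr ⟨hzx, (Finset.mem_inter.mp hz).1⟩)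
        refine lt_of_le_of_lt ((Finset.card_le_card hsub).trans Finset.card_image_le) ?_
        exact lt_of_lt_of_le (Finset.card_erase_lt_of_mem (by simpa using hvx)) (hdeg v)
    obtain ⟨c, hc⟩ : ∃ c, c ∉ (G.neighborFinset v ∩ (B ∪ D.erase v)).image g := by
      by_contra hcon
      push Not at hcon
      have := Finset.card_le_card (fun c _ => hcon c : Finset.univ ⊆ _)
      rw [Finset.card_univ, Fintype.card_fin] at this
      omega
    refine ⟨Function.update g v c, ?_, fun u hu => ?_⟩
    · have : B ∪ D = insert v (B ∪ D.erase v) := by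
        rw [← Finset.union_insert, Finset.insert_erase hvD]
      rw [this]
      refine hg.update_insert fun u hu hvu hguc => hc ?_
      exact Finset.mem_image.mpr ⟨u, Finset.mem_inter.mpr ⟨by simpa using hvu, hu⟩, hguc⟩
    · rw [Function.update_of_ne (by rintro rfl; exact hvB hu), hgf u hu]

/-- A path of length `r` inside `S`, listed as a function on `ℕ`. -/
structure IsPathIn (G : SimpleGraph V) (S : Finset V) (p : ℕ → V) (r : ℕ) : Prop where
  mem : ∀ i ≤ r, p i ∈ S
  adj : ∀ i < r, G.Adj (p i) (p (i + 1))
  inj : ∀ i ≤ r, ∀ j ≤ r, p i = p j → i = j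

/-- A path can be prolonged at its end until all neighbours of its last vertex lie on it. -/
theorem IsPathIn.exists_maximal {S : Finset V} {q : ℕ → V} {k : ℕ}
    (hq : G.IsPathIn S q k) :
    ∃ p r, k ≤ r ∧ G.IsPathIn S p r ∧ (∀ i ≤ k, p i = q i) ∧
      ∀ w ∈ S, G.Adj (p r) w → ∃ i < r, p i = w := by
  by_contra hcon
  push Not at hcon
  have step : ∀ m, ∃ p, G.IsPathIn S p (k + m) ∧ ∀ i ≤ k, p i = q i := by
    intro m
    induction m with
    | zero => exact ⟨q, hq, fun _ _ => rfl⟩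
    | succ m ih =>
      obtain ⟨p, hp, hpq⟩ := ih
      obtain ⟨w, hwS, hw, hwp⟩ := hcon p (k + m) (by omega) hp hpq
      have hwp' : ∀ i ≤ k + m, p i ≠ w := by
        intro i hi
        rcases hi.lt_or_eq with hi | rfl
        · exact hwp i hi
        · exact hw.ne
      refine ⟨fun i => if i ≤ k + m then p i else w, ⟨?_, ?_, ?_⟩, ?_⟩
      · intro i _
        split_ifs with hi
        exacts [hp.mem i hi, hwS]
      · intro i hi
        rw [if_pos (by omega : i ≤ k + m)]
        split_ifs with hi'
        · exact hp.adj i (by omega)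
        · obtain rfl : i = k + m := by omega
          exact hw
      · intro i hi j hj
        split_ifs with h1 h2 h2
        · exact hp.inj i h1 j h2
        · exact fun h => absurd h (hwp' i h1)
        · exact fun h => absurd h.symm (hwp' j h2)
        · intro; omega
      · intro i hi
        dsimp only
        rw [if_pos (by omega), hpq i hi]
  -- A path with more than `S.card` vertices cannot lie in `S`.
  obtain ⟨p, hp, -⟩ := step S.card
  have := Finset.card_le_card_of_injOn (s := Finset.range (k + S.card + 1)) (t := S) p
    (fun i hi => hp.mem i (by simp at hi; omega))
    (fun i hi j hj h => hp.inj i (by simp at hi; omega) j (by simp at hj; omega) h)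
  simp at this

/-- A colouring of the complement of a cycle, all of whose vertices have at most `d` neighbours,
extends to the cycle if two consecutive vertices `p i`, `p (i + 1)` of the cycle are such that
only the first has a neighbour outside. -/
theorem ProperOn.exists_extend_cycle [Fintype V] [DecidableEq V] [DecidableRel G.Adj] {d : ℕ}
    {f : V → Fin d} {B : Finset V} (hf : G.ProperOn f B) (hdeg : ∀ v, G.degree v ≤ d)
    {p : ℕ → V} {i j r : ℕ} (hj : j ≤ i) (hi : i < r)
    (hadj : ∀ k, j ≤ k → k < r → G.Adj (p k) (p (k + 1))) (hclose : G.Adj (p r) (p j))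
    (hinj : ∀ k ≤ r, ∀ l ≤ r, p k = p l → k = l)
    (hB : ∀ k, j ≤ k → k ≤ r → p k ∉ B) {u : V} (hu : u ∈ B) (hiu : G.Adj (p i) u)
    (hout : ∀ w ∈ B, ¬ G.Adj (p (i + 1)) w) :
    ∃ g : V → Fin d, G.ProperOn g (B ∪ (Finset.Icc j r).image p) := by
  have hf' := hf.update_insert (v := p (i + 1)) (c := f u)
    fun w hw hw' => absurd hw' (hout w hw)
  have hne : ∀ k, j ≤ k → k ≤ r → k ≠ i + 1 → p k ∉ insert (p (i + 1)) B := by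
    intro k hjk hkr hki hk
    rcases Finset.mem_insert.mp hk with hk | hk
    · exact hki (hinj _ hkr _ hi hk)
    · exact hB k hjk hkr hk
  have hDmem : ∀ U ⊆ ((Finset.Icc j r).erase (i + 1)).image p, ∀ v ∈ U,
      ∃ k, j ≤ k ∧ k ≤ r ∧ k ≠ i + 1 ∧ p k = v := by
    intro U hU v hv
    obtain ⟨k, hk, rfl⟩ := Finset.mem_image.mp (hU hv)
    simp only [Finset.mem_erase, Finset.mem_Icc] at hk
    exact ⟨k, hk.2.1, hk.2.2, hk.1, rfl⟩
  obtain ⟨g, hg, -⟩ := hf'.exists_extend hdeg (((Finset.Icc j r).erase (i + 1)).image p) (by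
    intro U hU hUne
    -- The colouring order is `p (i + 2)`, ..., `p r`, `p j`, ..., `p i`. Each vertex but the last
    -- precedes a neighbour; `p i` sees one colour on both `u` and `p (i + 1)`.
    by_cases hiU : p i ∈ U
    · refine ⟨p i, hiU, Or.inr (Or.inr ⟨u, Finset.mem_insert_of_mem hu, p (i + 1),
        Finset.mem_insert_self _ _, ?_, hiu, hadj i hj hi, ?_⟩)⟩
      · exact fun h => hB (i + 1) (by omega) hi (h ▸ hu)
      · rw [Function.update_self, Function.update_of_ne]
        exact fun h => hB (i + 1) (by omega) hi (h ▸ hu)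
    by_cases hlow : ∃ k, j ≤ k ∧ k ≤ i ∧ p k ∈ U
    · have hP : ∃ k ∈ (Finset.Icc j i).filter (fun k => p k ∈ U),
          ∀ l ∈ (Finset.Icc j i).filter (fun k => p k ∈ U), l ≤ k := by
        obtain ⟨k, hk1, hk2, hk3⟩ := hlow
        exact Finset.exists_max_image _ id ⟨k, by simp [hk1, hk2, hk3]⟩
      obtain ⟨k, hk, hmax⟩ := hP
      simp only [Finset.mem_filter, Finset.mem_Icc] at hk hmax
      have hki : k ≠ i := fun h => hiU (h ▸ hk.2)
      refine ⟨p k, hk.2, Or.inr (Or.inl ⟨p (k + 1), hadj k hk.1.1 (by omega),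
        hne _ (by omega) (by omega) (by omega), fun hmem => ?_⟩)⟩
      have := hmax (k + 1) ⟨⟨by omega, by omega⟩, hmem⟩
      omega
    · push Not at hlow
      have hP : ∃ k ∈ (Finset.Icc j r).filter (fun k => p k ∈ U),
          ∀ l ∈ (Finset.Icc j r).filter (fun k => p k ∈ U), l ≤ k := by
        obtain ⟨v, hv⟩ := hUne
        obtain ⟨k, hk1, hk2, hk3, rfl⟩ := hDmem U hU v hv
        exact Finset.exists_max_image _ id ⟨k, by simp [hk1, hk2, hv]⟩
      obtain ⟨k, hk, hmax⟩ := hP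
      simp only [Finset.mem_filter, Finset.mem_Icc] at hk hmax
      refine ⟨p k, hk.2, Or.inr (Or.inl ?_)⟩
      rcases hk.1.2.lt_or_eq with hkr | rfl
      · have hki : ¬ k ≤ i := fun h => hlow k hk.1.1 h hk.2
        refine ⟨p (k + 1), hadj k hk.1.1 hkr, hne _ (by omega) (by omega) (by omega),
          fun hmem => ?_⟩
        have := hmax (k + 1) ⟨⟨by omega, by omega⟩, hmem⟩
        omega
      · exact ⟨p j, hclose, hne _ le_rfl (by omega) (by omega), hlow j le_rfl hj⟩) (by
    rw [Finset.disjoint_right]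
    intro v hv
    obtain ⟨k, hk1, hk2, hk3, rfl⟩ := hDmem _ subset_rfl v hv
    exact hne k hk1 hk2 hk3)
  refine ⟨g, fun a ha b hb => ?_⟩
  have hsub : B ∪ (Finset.Icc j r).image p ⊆
      insert (p (i + 1)) B ∪ ((Finset.Icc j r).erase (i + 1)).image p := by
    intro v hv
    rcases Finset.mem_union.mp hv with hv | hv
    · exact Finset.mem_union_left _ (Finset.mem_insert_of_mem hv)
    · obtain ⟨k, hk, rfl⟩ := Finset.mem_image.mp hv
      by_cases hki : k = i + 1
      · subst hki; simp
      · exact Finset.mem_union_right _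
          (Finset.mem_image_of_mem _ (Finset.mem_erase.mpr ⟨hki, hk⟩))
  exact hg (hsub ha) (hsub hb)

/-- A set of vertices traversed by a path whose first and third vertices are not adjacent is
`d`-colourable if `d` bounds all degrees and the second vertex has a neighbour `p j`, `3 ≤ j`. -/
theorem exists_properOn_of_path [Fintype V] [DecidableEq V] [DecidableRel G.Adj] {d : ℕ}
    (hd : 0 < d) (hdeg : ∀ v, G.degree v ≤ d) {p : ℕ → V} {j r : ℕ} (hj : 3 ≤ j) (hjr : j ≤ r)
    (hadj : ∀ k < r, G.Adj (p k) (p (k + 1)))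
    (hinj : ∀ k ≤ r, ∀ l ≤ r, p k = p l → k = l)
    (h02 : ¬ G.Adj (p 0) (p 2)) (h1j : G.Adj (p 1) (p j)) :
    ∃ g : V → Fin d, G.ProperOn g ((Finset.range (r + 1)).image p) := by
  have hf : G.ProperOn (fun _ => (⟨0, hd⟩ : Fin d)) {p 0, p 2} := by
    intro a ha b hb hab
    simp only [Finset.mem_insert, Finset.mem_singleton] at ha hb
    rcases ha with rfl | rfl <;> rcases hb with rfl | rfl
    · exact absurd hab (G.irrefl)
    · exact absurd hab h02
    · exact absurd hab.symm h02
    · exact absurd hab (G.irrefl)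
  have hne : ∀ k ≤ r, k ≠ 0 → k ≠ 2 → p k ∉ ({p 0, p 2} : Finset V) := by
    intro k hk h0 h2 hmem
    simp only [Finset.mem_insert, Finset.mem_singleton] at hmem
    rcases hmem with h | h
    · exact h0 (hinj _ hk _ (by omega) h)
    · exact h2 (hinj _ hk _ (by omega) h)
  have hDmem : ∀ U ⊆ (((Finset.range (r + 1)).erase 0).erase 2).image p, ∀ v ∈ U,
      ∃ k ≤ r, k ≠ 0 ∧ k ≠ 2 ∧ p k = v := by
    intro U hU v hv
    obtain ⟨k, hk, rfl⟩ := Finset.mem_image.mp (hU hv)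
    simp only [Finset.mem_erase, Finset.mem_range] at hk
    exact ⟨k, by omega, hk.2.1, hk.1, rfl⟩
  obtain ⟨g, hg, -⟩ := hf.exists_extend hdeg
    ((((Finset.range (r + 1)).erase 0).erase 2).image p) (by
    intro U hU hUne
    -- The colouring order is `p r`, ..., `p (j + 1)`, then `p 3`, ..., `p j`, then `p 1`. Each
    -- vertex but the last precedes a neighbour; `p 1` sees `p 0` and `p 2` in one colour.
    by_cases h1U : p 1 ∈ U
    · refine ⟨p 1, h1U, Or.inr (Or.inr ⟨p 0, by simp, p 2, by simp, fun h => ?_,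
        (hadj 0 (by omega)).symm, hadj 1 (by omega), rfl⟩)⟩
      have := hinj _ (by omega) _ (by omega) h
      omega
    by_cases hjU : p j ∈ U
    · exact ⟨p j, hjU, Or.inr (Or.inl ⟨p 1, h1j.symm, hne 1 (by omega) (by omega) (by omega),
        h1U⟩)⟩
    by_cases hlow : ∃ k, 3 ≤ k ∧ k < j ∧ p k ∈ U
    · have hP : ∃ k ∈ (Finset.Ico 3 j).filter (fun k => p k ∈ U),
          ∀ l ∈ (Finset.Ico 3 j).filter (fun k => p k ∈ U), l ≤ k := by
        obtain ⟨k, hk1, hk2, hk3⟩ := hlow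
        exact Finset.exists_max_image _ id ⟨k, by simp [hk1, hk2, hk3]⟩
      obtain ⟨k, hk, hmax⟩ := hP
      simp only [Finset.mem_filter, Finset.mem_Ico] at hk hmax
      refine ⟨p k, hk.2, Or.inr (Or.inl ⟨p (k + 1), hadj k (by omega),
        hne _ (by omega) (by omega) (by omega), fun hmem => ?_⟩)⟩
      rcases (show k + 1 ≤ j by omega).lt_or_eq with hlt | heq
      · have := hmax (k + 1) ⟨⟨by omega, hlt⟩, hmem⟩
        omega
      · exact hjU (heq ▸ hmem)
    · push Not at hlow
      have hP : ∃ k ∈ (Finset.Icc 3 r).filter (fun k => p k ∈ U),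
          ∀ l ∈ (Finset.Icc 3 r).filter (fun k => p k ∈ U), k ≤ l := by
        obtain ⟨v, hv⟩ := hUne
        obtain ⟨k, hk, hk0, hk2, rfl⟩ := hDmem U hU v hv
        have hk1 : k ≠ 1 := fun h => h1U (h ▸ hv)
        exact Finset.exists_min_image _ id ⟨k, by simp [hv, hk]; omega⟩
      obtain ⟨k, hk, hmin⟩ := hP
      simp only [Finset.mem_filter, Finset.mem_Icc] at hk hmin
      have hkj : ¬ k < j := fun h => hlow k hk.1.1 h hk.2
      have hkj' : k ≠ j := fun h => hjU (h ▸ hk.2)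
      have hadj' := hadj (k - 1) (by omega)
      rw [show k - 1 + 1 = k by omega] at hadj'
      refine ⟨p k, hk.2, Or.inr (Or.inl ⟨p (k - 1), hadj'.symm,
        hne _ (by omega) (by omega) (by omega), fun hmem => ?_⟩)⟩
      have := hmin (k - 1) ⟨⟨by omega, by omega⟩, hmem⟩
      omega) (by
    rw [Finset.disjoint_right]
    intro v hv
    obtain ⟨k, hk, hk0, hk2, rfl⟩ := hDmem _ subset_rfl v hv
    exact hne k hk hk0 hk2)
  refine ⟨g, fun a ha b hb => ?_⟩
  have hsub : (Finset.range (r + 1)).image p ⊆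
      {p 0, p 2} ∪ (((Finset.range (r + 1)).erase 0).erase 2).image p := by
    intro v hv
    obtain ⟨k, hk, rfl⟩ := Finset.mem_image.mp hv
    by_cases hk0 : k = 0
    · subst hk0; simp
    by_cases hk2 : k = 2
    · subst hk2; simp
    exact Finset.mem_union_right _ (Finset.mem_image_of_mem _
      (Finset.mem_erase.mpr ⟨hk2, Finset.mem_erase.mpr ⟨hk0, hk⟩⟩))
  exact hg (hsub ha) (hsub hb)

/-- In a minimal uncolourable set all vertices have degree `d` and all their neighbours in it. -/
theorem degree_eq_and_adj_mem_of_minimal [Fintype V] [DecidableEq V] [DecidableRel G.Adj] {d : ℕ}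
    (hdeg : ∀ v, G.degree v ≤ d) {S : Finset V}
    (hS : ¬ ∃ f : V → Fin d, G.ProperOn f S)
    (hmin : ∀ T ⊂ S, ∃ f : V → Fin d, G.ProperOn f T) {v : V} (hv : v ∈ S) :
    G.degree v = d ∧ ∀ w, G.Adj v w → w ∈ S := by
  by_contra hcon
  obtain ⟨f, hf⟩ := hmin _ (Finset.erase_ssubset hv)
  obtain ⟨g, hg, -⟩ := hf.exists_extend hdeg {v} (by
    intro U hU hUne
    have hUv : U = {v} := (Finset.Nonempty.subset_singleton_iff hUne).mp hU
    subst hUv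
    refine ⟨v, by simp, ?_⟩
    by_cases hlt : G.degree v < d
    · exact Or.inl hlt
    · have : ¬ ∀ w, G.Adj v w → w ∈ S :=
        fun h => hcon ⟨le_antisymm (hdeg v) (not_lt.mp hlt), h⟩
      push Not at this
      obtain ⟨w, hvw, hw⟩ := this
      exact Or.inr (Or.inl ⟨w, hvw, fun h => hw (Finset.mem_of_mem_erase h),
        by simpa using hvw.ne'⟩)) (by simp)
  refine hS ⟨g, ?_⟩
  have : S.erase v ∪ {v} = S := by
    rw [Finset.union_comm, ← Finset.insert_eq, Finset.insert_erase hv]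
  rwa [this] at hg

/-- A minimal uncolourable set is connected: with no edge between `C` and `S \ C`, colourings of the
two parts could be glued. -/
theorem exists_adj_sdiff_of_minimal [DecidableEq V] {α : Type*} {S : Finset V}
    (hS : ¬ ∃ f : V → α, G.ProperOn f S)
    (hmin : ∀ T ⊂ S, ∃ f : V → α, G.ProperOn f T) {C : Finset V} (hC : C ⊂ S)
    (hne : C.Nonempty) : ∃ c ∈ C, ∃ u ∈ S \ C, G.Adj c u := by
  by_contra hcon
  push Not at hcon
  obtain ⟨f, hf⟩ := hmin C hC
  obtain ⟨g, hg⟩ := hmin (S \ C) (Finset.sdiff_ssubset hC.1 hne)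
  refine hS ⟨fun v => if v ∈ C then f v else g v, fun a ha b hb hab => ?_⟩
  dsimp only
  split_ifs with h1 h2 h2
  · exact hf h1 h2 hab
  · exact absurd hab (hcon a h1 b (Finset.mem_sdiff.mpr ⟨hb, h2⟩))
  · exact absurd hab.symm (hcon b h2 a (Finset.mem_sdiff.mpr ⟨ha, h1⟩))
  · exact hg (Finset.mem_sdiff.mpr ⟨ha, h1⟩) (Finset.mem_sdiff.mpr ⟨hb, h2⟩) hab

/-- In a minimal uncolourable `S`, take a path starting `a`, `b`, `c` with `a`, `c` non-adjacent,
prolonged until its end has all neighbours on it. If it covers `S`, a third neighbour of `b`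
supplies a greedy order. Otherwise the end closes a cycle missing part of `S`, and a colouring of
the rest extends over that cycle. -/
theorem exists_properOn_of_degree_le [Fintype V] [DecidableEq V] [DecidableRel G.Adj] {d : ℕ}
    (hd : 3 ≤ d) (hdeg : ∀ v, G.degree v ≤ d) (hcl : G.CliqueFree (d + 1)) (S : Finset V) :
    ∃ f : V → Fin d, G.ProperOn f S := by
  induction S using Finset.strongInduction with
  | H S hmin =>
  by_contra hS
  have hfull := fun v (hv : v ∈ S) => degree_eq_and_adj_mem_of_minimal hdeg hS hmin hv
  have hSne : S.Nonempty := by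
    rw [Finset.nonempty_iff_ne_empty]
    rintro rfl
    exact hS ⟨fun _ => ⟨0, by omega⟩, fun a ha => by simp at ha⟩
  obtain ⟨b, hb⟩ := hSne
  -- Otherwise `b` and its `d` neighbours form a clique of size `d + 1`.
  obtain ⟨a, c, hba, hbc, hac, hnac⟩ : ∃ a c, G.Adj b a ∧ G.Adj b c ∧ a ≠ c ∧ ¬ G.Adj a c := by
    by_contra hcon
    push Not at hcon
    refine hcl (insert b (G.neighborFinset b)) ⟨?_, ?_⟩
    · intro x hx y hy hxy
      simp only [Finset.coe_insert, coe_neighborFinset, Set.mem_insert_iff,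
        mem_neighborSet] at hx hy
      rcases hx with rfl | hx <;> rcases hy with rfl | hy
      · exact absurd rfl hxy
      · exact hy
      · exact hx.symm
      · exact hcon x y hx hy hxy
    · rw [Finset.card_insert_of_notMem (by simp), card_neighborFinset_eq_degree, (hfull b hb).1]
  have hq : G.IsPathIn S (fun i => if i = 0 then a else if i = 1 then b else c) 2 := by
    refine ⟨?_, ?_, ?_⟩
    · intro i _
      split_ifs
      exacts [(hfull b hb).2 a hba, hb, (hfull b hb).2 c hbc]
    · intro i hi
      interval_cases i
      · simpa using hba.symm
      · simpa using hbc
    · intro i hi j hj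
      interval_cases i <;> interval_cases j <;>
        simp [hac, hac.symm, hba.ne, hba.ne', hbc.ne, hbc.ne']
  obtain ⟨p, r, hr, hp, hpq, hend⟩ := hq.exists_maximal
  have hp0 : p 0 = a := by simpa using hpq 0 (by omega)
  have hp1 : p 1 = b := by simpa using hpq 1 (by omega)
  have hp2 : p 2 = c := by simpa using hpq 2 (by omega)
  have hrS := hp.mem r le_rfl
  have hend' : ∀ w, G.Adj (p r) w → ∃ i < r, p i = w :=
    fun w hw => hend w ((hfull _ hrS).2 w hw) hw
  by_cases hcover : (Finset.range (r + 1)).image p = S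
  · have h3 : ∃ j, 3 ≤ j ∧ j ≤ r ∧ G.Adj (p 1) (p j) := by
      by_contra hcon
      push Not at hcon
      have hsub : G.neighborFinset b ⊆ {a, c} := by
        intro w hw
        rw [mem_neighborFinset] at hw
        have hwS := (hfull b hb).2 w hw
        rw [← hcover] at hwS
        obtain ⟨k, hk, rfl⟩ := Finset.mem_image.mp hwS
        rw [Finset.mem_range] at hk
        have hk3 : ¬ 3 ≤ k := fun h => hcon k h (by omega) (hp1 ▸ hw)
        have hk1 : k ≠ 1 := by
          rintro rfl
          rw [hp1] at hw
          exact G.irrefl hw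
        obtain rfl | rfl : k = 0 ∨ k = 2 := by omega
        · simp [hp0]
        · simp [hp2]
      have := (Finset.card_le_card hsub).trans Finset.card_le_two
      rw [card_neighborFinset_eq_degree, (hfull b hb).1] at this
      omega
    obtain ⟨j, hj3, hjr, h1j⟩ := h3
    obtain ⟨g, hg⟩ := exists_properOn_of_path (d := d) (by omega) hdeg hj3 hjr hp.adj hp.inj
      (by rwa [hp0, hp2]) h1j
    exact hS ⟨g, hcover ▸ hg⟩
  -- The least `j` with `p j` adjacent to `p r` gives a cycle `p j`, ..., `p r` containing every
  -- neighbour of `p r`. Hence the last cycle vertex `p i` with a neighbour outside has `i < r`, and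
  -- `p (i + 1)` has none.
  · have hex : ∃ j, G.Adj (p r) (p j) ∧ j < r :=
      ⟨r - 1, by
        have := hp.adj (r - 1) (by omega)
        rw [show r - 1 + 1 = r by omega] at this
        exact this.symm, by omega⟩
    classical
    obtain ⟨hj, hjr⟩ := Nat.find_spec hex
    have hjmin := fun k (hk : G.Adj (p r) (p k) ∧ k < r) => Nat.find_min' hex hk
    generalize Nat.find hex = j at hj hjr hjmin
    have hCS : (Finset.Icc j r).image p ⊂ S := by
      refine Finset.ssubset_iff_subset_ne.mpr ⟨?_, fun heq => hcover ?_⟩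
      · intro v hv
        obtain ⟨k, hk, rfl⟩ := Finset.mem_image.mp hv
        exact hp.mem k (Finset.mem_Icc.mp hk).2
      · refine subset_antisymm ?_ ?_
        · intro v hv
          obtain ⟨k, hk, rfl⟩ := Finset.mem_image.mp hv
          exact hp.mem k (by simpa [Nat.lt_succ_iff] using hk)
        · rw [← heq]
          refine Finset.image_subset_image fun k hk => ?_
          simp only [Finset.mem_Icc, Finset.mem_range] at hk ⊢
          omega
    have hCne : ((Finset.Icc j r).image p).Nonempty :=
      (Finset.nonempty_Icc.mpr hjr.le).image p
    have hI : ∃ i ∈ (Finset.Icc j r).filter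
          (fun i => ∃ u ∈ S \ (Finset.Icc j r).image p, G.Adj (p i) u),
        ∀ l ∈ (Finset.Icc j r).filter
          (fun i => ∃ u ∈ S \ (Finset.Icc j r).image p, G.Adj (p i) u), l ≤ i := by
      obtain ⟨x, hx, u, hu, hxu⟩ := exists_adj_sdiff_of_minimal hS hmin hCS hCne
      obtain ⟨k, hk, rfl⟩ := Finset.mem_image.mp hx
      exact Finset.exists_max_image _ id ⟨k, Finset.mem_filter.mpr ⟨hk, u, hu, hxu⟩⟩
    obtain ⟨i, hi, himax⟩ := hI
    obtain ⟨hi, u, hu, hiu⟩ := Finset.mem_filter.mp hi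
    rw [Finset.mem_Icc] at hi
    have hir : i < r := by
      refine lt_of_le_of_ne hi.2 ?_
      rintro rfl
      obtain ⟨k, hk, rfl⟩ := hend' u hiu
      refine (Finset.mem_sdiff.mp hu).2 (Finset.mem_image_of_mem _ (Finset.mem_Icc.mpr ⟨?_, hk.le⟩))
      exact hjmin k ⟨hiu, hk⟩
    obtain ⟨f, hf⟩ := hmin _ (Finset.sdiff_ssubset hCS.1 hCne)
    obtain ⟨g, hg⟩ := hf.exists_extend_cycle hdeg hi.1 hir (fun k _ hk => hp.adj k hk) hj hp.inj
      (fun k hk1 hk2 hmem => (Finset.mem_sdiff.mp hmem).2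
        (Finset.mem_image_of_mem _ (Finset.mem_Icc.mpr ⟨hk1, hk2⟩))) hu hiu
      (fun w hw hadj => by
        have := himax (i + 1) (Finset.mem_filter.mpr
          ⟨Finset.mem_Icc.mpr ⟨by omega, by omega⟩, w, hw, hadj⟩)
        omega)
    rw [Finset.sdiff_union_of_subset hCS.1] at hg
    exact hS ⟨g, hg⟩

/-- **Brooks' theorem** for maximum degree at least three. -/
theorem colorable_of_degree_le_of_cliqueFree [Fintype V] [DecidableRel G.Adj] {d : ℕ}
    (hd : 3 ≤ d) (hdeg : ∀ v, G.degree v ≤ d) (hcl : G.CliqueFree (d + 1)) :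
    G.Colorable d := by
  classical
  obtain ⟨f, hf⟩ := exists_properOn_of_degree_le hd hdeg hcl Finset.univ
  exact ⟨Coloring.mk f fun {u v} huv => hf (Finset.mem_univ u) (Finset.mem_univ v) huv⟩

theorem colorable_of_degree_lt [Fintype V] [DecidableRel G.Adj] {d : ℕ}
    (hdeg : ∀ v, G.degree v < d) : G.Colorable d := by
  classical
  by_cases hV : Nonempty V
  · obtain ⟨v₀⟩ := hV
    have hf : G.ProperOn (fun _ => (⟨0, (Nat.zero_le _).trans_lt (hdeg v₀)⟩ : Fin d)) ∅ :=
      fun a ha => by simp at ha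
    obtain ⟨g, hg, -⟩ := hf.exists_extend (fun v => (hdeg v).le) Finset.univ
      (fun U _ ⟨v, hv⟩ => ⟨v, hv, Or.inl (hdeg v)⟩) (by simp)
    exact ⟨Coloring.mk g fun {u v} huv => hg (by simp) (by simp) huv⟩
  · exact ⟨Coloring.mk (fun v => absurd ⟨v⟩ hV) fun {u} => absurd ⟨u⟩ hV⟩

end SimpleGraph

/-! ### Odd cycles, stable sets and induced subgraphs -/

namespace SimpleGraph

variable {V : Type*} {G : SimpleGraph V}

/-- A shortest odd closed walk is an induced odd cycle. -/
theorem exists_cycleGraph_embedding_of_not_colorable_two (h : ¬ G.Colorable 2) :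
    ∃ n, 3 ≤ n ∧ Odd n ∧ Nonempty (cycleGraph n ↪g G) := by
  rw [two_colorable_iff_forall_loop_even] at h
  push Not at h
  have hex : ∃ n, Odd n ∧ ∃ u, ∃ w : G.Walk u u, w.length = n := by
    obtain ⟨u, w, hw⟩ := h
    exact ⟨w.length, Nat.not_even_iff_odd.mp hw, u, w, rfl⟩
  classical
  obtain ⟨hodd, u, w, hw⟩ := Nat.find_spec hex
  have hmin : ∀ (x : V) (q : G.Walk x x), Odd q.length → Nat.find hex ≤ q.length :=
    fun x q hq => Nat.find_min' hex ⟨hq, x, q, rfl⟩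
  generalize Nat.find hex = n at hodd hw hmin
  -- `inner` and `outer` are the two arcs between positions `i` and `j` of the closed walk; their
  -- lengths sum to `n`.
  have inner : ∀ i j, i ≤ j → j ≤ n →
      ∃ q : G.Walk (w.getVert i) (w.getVert j), q.length = j - i := by
    intro i j hij hjn
    refine ⟨((w.drop i).take (j - i)).copy rfl (by
      rw [Walk.drop_getVert, Nat.add_sub_cancel' hij]), ?_⟩
    rw [Walk.length_copy, Walk.take_length, Walk.drop_length, hw]
    omega
  have outer : ∀ i j, i ≤ j → j ≤ n →
      ∃ q : G.Walk (w.getVert j) (w.getVert i), q.length = n - (j - i) := by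
    intro i j hij hjn
    refine ⟨(w.drop j).append (w.take i), ?_⟩
    rw [Walk.length_append, Walk.take_length, Walk.drop_length, hw]
    omega
  -- A repeated vertex would split the walk into two shorter closed walks, one of them odd.
  have hne : ∀ i j, i < j → j < n → w.getVert i ≠ w.getVert j := by
    intro i j hij hjn heq
    obtain ⟨q, hq⟩ := inner i j hij.le hjn.le
    obtain ⟨q', hq'⟩ := outer i j hij.le hjn.le
    have h1 := hmin _ (q.copy rfl heq.symm)
    have h2 := hmin _ (q'.copy rfl heq)
    rw [Walk.length_copy] at h1 h2
    rw [Nat.odd_iff] at h1 h2 hodd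
    omega
  -- A chord closes both arcs into closed walks of total length `n + 2`. One is odd, so has length
  -- at least `n`, leaving the other arc a single edge.
  have hchord : ∀ i j, i < j → j < n → G.Adj (w.getVert i) (w.getVert j) →
      j - i = 1 ∨ j - i = n - 1 := by
    intro i j hij hjn hadj
    obtain ⟨q, hq⟩ := inner i j hij.le hjn.le
    obtain ⟨q', hq'⟩ := outer i j hij.le hjn.le
    have h1 := hmin _ (q.concat hadj.symm)
    have h2 := hmin _ (q'.concat hadj)
    rw [Walk.length_concat] at h1 h2
    rw [Nat.odd_iff] at h1 h2 hodd
    omega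
  have hsucc : ∀ i < n, G.Adj (w.getVert i) (w.getVert (i + 1)) :=
    fun i hi => w.adj_getVert_succ (hw ▸ hi)
  have hn1 : n ≠ 1 := by
    rintro rfl
    exact G.irrefl (Walk.adj_of_length_eq_one hw)
  have hn : 3 ≤ n := by
    rw [Nat.odd_iff] at hodd
    omega
  have hlast : G.Adj (w.getVert 0) (w.getVert (n - 1)) := by
    have := hsucc (n - 1) (by omega)
    rw [show n - 1 + 1 = w.length by omega, Walk.getVert_length] at this
    rw [Walk.getVert_zero]
    exact this.symm
  have hadj : ∀ i j, i < j → j < n →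
      (G.Adj (w.getVert i) (w.getVert j) ↔ j - i = 1 ∨ j - i = n - 1) := by
    intro i j hij hjn
    refine ⟨hchord i j hij hjn, ?_⟩
    rintro (h | h)
    · obtain rfl : j = i + 1 := by omega
      exact hsucc i (by omega)
    · obtain ⟨rfl, rfl⟩ : i = 0 ∧ j = n - 1 := by omega
      exact hlast
  have hcyc : ∀ i j : Fin n, i < j →
      ((cycleGraph n).Adj i j ↔ j.val - i.val = 1 ∨ j.val - i.val = n - 1) := by
    intro i j hij
    rw [cycleGraph_adj', Fin.sub_val_of_le hij.le, Fin.coe_sub_iff_lt.mpr hij]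
    have := i.isLt
    have := j.isLt
    rw [Fin.lt_def] at hij
    omega
  have hinj : Function.Injective fun i : Fin n => w.getVert i := by
    intro i j hij
    rcases lt_trichotomy i j with h | h | h
    · exact absurd hij (hne _ _ h j.isLt)
    · exact h
    · exact absurd hij.symm (hne _ _ h i.isLt)
  refine ⟨n, hn, hodd, ⟨⟨⟨fun i => w.getVert i, hinj⟩, ?_⟩⟩⟩
  intro i j
  change G.Adj (w.getVert i) (w.getVert j) ↔ _
  rcases lt_trichotomy i j with h | rfl | h
  · rw [hadj _ _ h j.isLt, hcyc _ _ h]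
  · simp
  · rw [adj_comm, hadj _ _ h i.isLt, adj_comm, hcyc _ _ h]

/-- Maximality makes each remaining vertex of `X` lose a neighbour when `M` is deleted. A proper `X`
is needed for the second stable set, chosen disjoint from the first. -/
theorem exists_isIndepSet_maximal [Finite V] {A X : Set V} (hA : G.IsIndepSet A) (hAX : A ⊆ X) :
    ∃ M, A ⊆ M ∧ M ⊆ X ∧ G.IsIndepSet M ∧ ∀ v ∈ X, v ∉ M → ∃ a ∈ M, G.Adj v a := by
  obtain ⟨M, hAM, hM⟩ := (Set.toFinite {M : Set V | M ⊆ X ∧ G.IsIndepSet M}).exists_le_maximal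
    (a := A) ⟨hAX, hA⟩
  refine ⟨M, hAM, hM.prop.1, hM.prop.2, fun v hvX hvM => ?_⟩
  by_contra hcon
  push Not at hcon
  refine hvM (hM.le_of_ge (y := insert v M) ⟨Set.insert_subset hvX hM.prop.1, ?_⟩
    (Set.subset_insert v M) (Set.mem_insert v M))
  intro x hx y hy hxy
  rcases hx with rfl | hx <;> rcases hy with rfl | hy
  · exact absurd rfl hxy
  · exact hcon y hy
  · exact fun h => hcon x hx h.symm
  · exact hM.prop.2 hx hy hxy

theorem Colorable.add_of_induce_compl {R : Set V} {m k : ℕ} (hR : (G.induce R).Colorable m)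
    (hRc : (G.induce Rᶜ).Colorable k) : G.Colorable (m + k) := by
  classical
  obtain ⟨f⟩ := hR
  obtain ⟨g⟩ := hRc
  have : G.Coloring (Fin m ⊕ Fin k) := Coloring.mk
    (fun v => if h : v ∈ R then Sum.inl (f ⟨v, h⟩) else Sum.inr (g ⟨v, h⟩)) (by
      intro u v huv
      by_cases hu : u ∈ R <;> by_cases hv : v ∈ R <;> simp only [hu, hv, dif_pos, dif_neg,
        not_false_eq_true, ne_eq, Sum.inl.injEq, Sum.inr.injEq, reduceCtorEq]
      · exact f.valid (by simpa using huv)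
      · exact g.valid (by simpa using huv))
  simpa using this.colorable

theorem degree_induce_add_card_le [Fintype V] [DecidableRel G.Adj] {R : Set V}
    [Fintype R] [DecidableRel (G.induce R).Adj] (v : R) (s : Finset V)
    (hs : ∀ x ∈ s, G.Adj v x ∧ x ∉ R) : (G.induce R).degree v + s.card ≤ G.degree v := by
  classical
  rw [← card_neighborFinset_eq_degree, ← card_neighborFinset_eq_degree,
    ← Finset.card_map (Function.Embedding.subtype (· ∈ R)), ← Finset.card_union_of_disjoint]
  · refine Finset.card_le_card fun x hx => ?_
    rw [mem_neighborFinset]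
    rcases Finset.mem_union.mp hx with hx | hx
    · obtain ⟨y, hy, rfl⟩ := Finset.mem_map.mp hx
      simpa using hy
    · exact (hs x hx).1
  · rw [Finset.disjoint_left]
    intro x hx hxs
    obtain ⟨y, -, rfl⟩ := Finset.mem_map.mp hx
    exact (hs _ hxs).2 y.2

theorem two_le_cliqueNum_of_maxDegree_pos [Fintype V] [DecidableRel G.Adj]
    (h : 0 < G.maxDegree) : 2 ≤ G.cliqueNum := by
  classical
  obtain ⟨v, hv⟩ : ∃ v, 0 < G.degree v := by
    by_contra hcon
    push Not at hcon
    exact absurd (G.maxDegree_le_of_forall_degree_le 0 hcon) (by omega)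
  obtain ⟨w, hw⟩ := (G.degree_pos_iff_exists_adj v).mp hv
  have hc : G.IsClique (({v, w} : Finset V) : Set V) := by
    rw [Finset.coe_pair]
    rintro x (rfl | rfl) y (rfl | rfl) hxy
    exacts [absurd rfl hxy, hw, hw.symm, absurd rfl hxy]
  have := hc.card_le_cliqueNum
  rwa [Finset.card_pair hw.ne] at this

end SimpleGraph

open SimpleGraph

/-! ### Reed's bound in integer form and the case Δ ≤ 4 -/

section Reed

variable {V : Type*} [Fintype V] {G : SimpleGraph V}

theorem satisfiesReed_iff [DecidableRel G.Adj] :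
    SatisfiesReed G ↔ G.Colorable ((G.maxDegree + G.cliqueNum + 2) / 2) := by
  have hceil : ⌈((G.maxDegree : ℚ) + (G.cliqueNum : ℚ) + 1) / 2⌉₊ =
      (G.maxDegree + G.cliqueNum + 2) / 2 := by
    generalize hm : G.maxDegree + G.cliqueNum = m
    have hm' : ((G.maxDegree : ℚ) + (G.cliqueNum : ℚ)) = m := by exact_mod_cast hm
    rw [hm']
    have h1 : 2 * ((m + 2) / 2) ≤ m + 2 := by omega
    have h2 : m + 1 ≤ 2 * ((m + 2) / 2) := by omega
    generalize (m + 2) / 2 = c at h1 h2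
    have h1' : (2 : ℚ) * c ≤ m + 2 := by exact_mod_cast h1
    have h2' : (m : ℚ) + 1 ≤ 2 * c := by exact_mod_cast h2
    apply le_antisymm
    · exact Nat.ceil_le.mpr (by linarith)
    · by_contra hlt
      have := Nat.le_ceil (((m : ℚ) + 1) / 2)
      have h3 : (⌈((m : ℚ) + 1) / 2⌉₊ : ℚ) + 1 ≤ c := by exact_mod_cast not_le.mp hlt
      linarith
  rw [SatisfiesReed, hceil, chromaticNumber_le_iff_colorable]

/-- Settles the case in which the deleted stable sets exhaust the graph: one edge already makes the
bound at least 2. -/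
theorem satisfiesReed_of_colorable_two [DecidableRel G.Adj] (h : G.Colorable 2)
    (hpos : 0 < G.maxDegree) : SatisfiesReed G := by
  rw [satisfiesReed_iff]
  have := G.two_le_cliqueNum_of_maxDegree_pos hpos
  exact h.mono (by omega)

/-- Deleting a `k`-colourable set that lowers the maximum degree by `2 * k` preserves Reed's
inequality upwards. -/
theorem satisfiesReed_of_induce [DecidableRel G.Adj] {R : Set V} [Fintype R]
    [DecidableRel (G.induce R).Adj] {k : ℕ} (hR : SatisfiesReed (G.induce R))
    (hRc : (G.induce Rᶜ).Colorable k) (hdeg : (G.induce R).maxDegree + 2 * k ≤ G.maxDegree) :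
    SatisfiesReed G := by
  rw [satisfiesReed_iff] at hR ⊢
  have := G.cliqueNum_induce_le R
  exact (hR.add_of_induce_compl hRc).mono (by omega)

/-- Reed's inequality for maximum degree at most four, by Brooks' theorem. -/
theorem satisfiesReed_of_maxDegree_le_four [DecidableRel G.Adj] (h : G.maxDegree ≤ 4) :
    SatisfiesReed G := by
  classical
  have hdeg := fun v => G.degree_le_maxDegree v
  have hgreedy : G.Colorable (G.maxDegree + 1) :=
    colorable_of_degree_lt fun v => Nat.lt_succ_of_le (hdeg v)
  rw [satisfiesReed_iff]
  rcases Nat.eq_zero_or_pos G.maxDegree with h0 | hpos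
  · exact hgreedy.mono (by omega)
  have h2 := G.two_le_cliqueNum_of_maxDegree_pos hpos
  by_cases hω : G.maxDegree ≤ G.cliqueNum
  · exact hgreedy.mono (by omega)
  rw [not_le] at hω
  -- Since 2 ≤ ω < Δ, the second alternative is vacuous. For Δ equal to 3 or 4, ω ≥ 2 makes the
  -- bound at least Δ, which is what Brooks' theorem gives.
  have hd : 3 ≤ G.maxDegree ∨ G.maxDegree ≤ 2 := by omega
  rcases hd with hd | hd
  · have hcl : G.CliqueFree (G.maxDegree + 1) := fun s hs => by
      have := hs.isClique.card_le_cliqueNum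
      rw [hs.card_eq] at this
      omega
    exact (colorable_of_degree_le_of_cliqueFree hd hdeg hcl).mono (by omega)
  · exact hgreedy.mono (by omega)

end Reed

/-! ### Deleting stable sets that contain the vertices of high degree -/

section HighDegree

variable {V : Type u} [Fintype V] {G : SimpleGraph V} [DecidableRel G.Adj] {Δ₀ : ℕ}

theorem satisfiesReed_of_isIndepSet
    (hReed : ∀ (W : Type u) [Fintype W] (H : SimpleGraph W) [DecidableRel H.Adj],
      H.maxDegree ≤ Δ₀ → SatisfiesReed H)
    (hG : G.IsIndepSet {v | Δ₀ + 1 ≤ G.degree v}) : SatisfiesReed G := by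
  classical
  by_cases hΔ : G.maxDegree ≤ Δ₀
  · exact hReed V G hΔ
  obtain ⟨M, hM, -, hMi, hMdom⟩ := exists_isIndepSet_maximal hG (Set.subset_univ _)
  have hcol : (G.induce Mᶜᶜ).Colorable 1 := by
    refine ⟨Coloring.mk (fun _ => 0) fun {x y} hxy => ?_⟩
    have hx : x.1 ∈ M := not_not.mp x.2
    have hy : y.1 ∈ M := not_not.mp y.2
    have hxy' : G.Adj x.1 y.1 := by simpa using hxy
    exact absurd hxy' (hMi hx hy hxy'.ne)
  have hdeg : ∀ v : ↥Mᶜ, (G.induce Mᶜ).degree v + 1 ≤ Δ₀ := by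
    intro v
    obtain ⟨a, ha, hva⟩ := hMdom v (Set.mem_univ _) v.2
    have h1 := degree_induce_add_card_le (G := G) v {a} (by simpa using ⟨hva, ha⟩)
    rw [Finset.card_singleton] at h1
    have h2 : ¬ Δ₀ + 1 ≤ G.degree v := fun h => v.2 (hM h)
    omega
  -- A remaining vertex forces Δ₀ ≥ 1, so the truncated subtraction `Δ₀ - 1` is genuine; an empty
  -- remainder is treated apart.
  by_cases hne : Nonempty ↥Mᶜ
  · have hmax : (G.induce Mᶜ).maxDegree ≤ Δ₀ - 1 :=
      maxDegree_le_of_forall_degree_le _ _ fun v => by have := hdeg v; omega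
    have := hdeg hne.some
    exact satisfiesReed_of_induce (hReed _ _ (by omega)) hcol (by omega)
  · have h0 : (G.induce Mᶜ).Colorable 0 :=
      ⟨Coloring.mk (fun v => absurd ⟨v⟩ hne) fun {v} => absurd ⟨v⟩ hne⟩
    exact satisfiesReed_of_colorable_two ((h0.add_of_induce_compl hcol).mono (by omega)) (by omega)

theorem satisfiesReed_of_induced_odd_cycle
    (hReed : ∀ (W : Type u) [Fintype W] (H : SimpleGraph W) [DecidableRel H.Adj],
      H.maxDegree ≤ Δ₀ → SatisfiesReed H)
    (hG : ∀ n : ℕ, 3 ≤ n → Odd n → ∀ C : cycleGraph n ↪g G,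
      ∃ i, G.degree (C i) + 1 ≤ Δ₀) : SatisfiesReed G := by
  classical
  by_cases hΔ : G.maxDegree ≤ Δ₀
  · exact hReed V G hΔ
  have hbip : (G.induce {v | Δ₀ ≤ G.degree v}).Colorable 2 := by
    by_contra hcon
    obtain ⟨n, hn, hodd, ⟨C⟩⟩ := exists_cycleGraph_embedding_of_not_colorable_two hcon
    obtain ⟨i, hi⟩ := hG n hn hodd (C.trans (Embedding.induce _))
    have : Δ₀ ≤ G.degree (C i).1 := (C i).2
    have hi' : G.degree (C i).1 + 1 ≤ Δ₀ := hi
    omega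
  obtain ⟨c⟩ := hbip
  have hclass : ∀ b : Fin 2,
      G.IsIndepSet {v | ∃ h : Δ₀ ≤ G.degree v, c ⟨v, h⟩ = b} := by
    rintro b x ⟨hx, hxb⟩ y ⟨hy, hyb⟩ - hxy
    exact c.valid (v := ⟨x, hx⟩) (w := ⟨y, hy⟩) (by simpa using hxy) (hxb.trans hyb.symm)
  obtain ⟨A, hA, -, hAi, hAdom⟩ := exists_isIndepSet_maximal (hclass 0) (Set.subset_univ _)
  -- `A` may have absorbed vertices of class 1, so only the rest of that class is put into `B`.
  -- Disjointness makes the lost neighbours in `A` and `B` distinct.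
  obtain ⟨B, hB, hBA, hBi, hBdom⟩ := exists_isIndepSet_maximal (X := Aᶜ)
    ((hclass 1).mono (Set.sdiff_subset (t := A))) (fun x hx => hx.2)
  have hcol : (G.induce (A ∪ B)ᶜᶜ).Colorable 2 := by
    refine ⟨Coloring.mk (fun x => if x.1 ∈ A then (0 : Fin 2) else 1) fun {x y} hxy => ?_⟩
    have hx : x.1 ∈ A ∪ B := not_not.mp x.2
    have hy : y.1 ∈ A ∪ B := not_not.mp y.2
    have hxy' : G.Adj x.1 y.1 := by simpa using hxy
    split_ifs with h1 h2 h2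
    · exact absurd hxy' (hAi h1 h2 hxy'.ne)
    · simp
    · simp
    · exact absurd hxy' (hBi (hx.resolve_left h1) (hy.resolve_left h2) hxy'.ne)
  -- The 3 is one for having degree below Δ₀ in `G`, and two for the lost neighbours.
  have hdeg : ∀ v : ↥(A ∪ B)ᶜ, (G.induce (A ∪ B)ᶜ).degree v + 3 ≤ Δ₀ := by
    intro v
    have hvA : v.1 ∉ A := fun h => v.2 (Or.inl h)
    have hvB : v.1 ∉ B := fun h => v.2 (Or.inr h)
    obtain ⟨a, ha, hva⟩ := hAdom v (Set.mem_univ _) hvA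
    obtain ⟨b, hb, hvb⟩ := hBdom v hvA hvB
    have hab : a ≠ b := by
      rintro rfl
      exact hBA hb ha
    have h1 := degree_induce_add_card_le (G := G) v {a, b} (by simp [hva, hvb, ha, hb])
    rw [Finset.card_pair hab] at h1
    have h2 : ¬ Δ₀ ≤ G.degree v := by
      intro h
      have h01 : ∀ b : Fin 2, b = 0 ∨ b = 1 := by decide
      rcases h01 (c ⟨v, h⟩) with h0 | h1
      · exact hvA (hA ⟨h, h0⟩)
      · exact hvB (hB ⟨⟨h, h1⟩, hvA⟩)
    omega
  by_cases hne : Nonempty ↥(A ∪ B)ᶜ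
  · have hmax : (G.induce (A ∪ B)ᶜ).maxDegree ≤ Δ₀ - 3 :=
      maxDegree_le_of_forall_degree_le _ _ fun v => by have := hdeg v; omega
    have := hdeg hne.some
    exact satisfiesReed_of_induce (hReed _ _ (by omega)) hcol (by omega)
  · have h0 : (G.induce (A ∪ B)ᶜ).Colorable 0 :=
      ⟨Coloring.mk (fun v => absurd ⟨v⟩ hne) fun {v} => absurd ⟨v⟩ hne⟩
    exact satisfiesReed_of_colorable_two ((h0.add_of_induce_compl hcol).mono (by omega)) (by omega)

end HighDegree

theorem theorem4 :
    (∀ Δ₀ : ℕ,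
      (∀ (W : Type u) [Fintype W] (H : SimpleGraph W) [DecidableRel H.Adj],
        H.maxDegree ≤ Δ₀ → SatisfiesReed H) →
      (∀ (V : Type u) [Fintype V] (G : SimpleGraph V) [DecidableRel G.Adj],
        G.IsIndepSet {v | Δ₀ + 1 ≤ G.degree v} → SatisfiesReed G) ∧
      (∀ (V : Type u) [Fintype V] (G : SimpleGraph V) [DecidableRel G.Adj],
        (∀ n : ℕ, 3 ≤ n → Odd n → ∀ C : SimpleGraph.cycleGraph n ↪g G,
          ∃ i, G.degree (C i) + 1 ≤ Δ₀) → SatisfiesReed G)) ∧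
    (∀ (V : Type u) [Fintype V] (G : SimpleGraph V) [DecidableRel G.Adj],
      (G.IsIndepSet {v | 5 ≤ G.degree v} ∨
        ∀ n : ℕ, 3 ≤ n → Odd n → ∀ C : SimpleGraph.cycleGraph n ↪g G,
          ∃ i, G.degree (C i) ≤ 3) → SatisfiesReed G) := by
  refine ⟨fun Δ₀ hReed => ⟨fun V _ G _ hG => satisfiesReed_of_isIndepSet hReed hG,
    fun V _ G _ hG => satisfiesReed_of_induced_odd_cycle hReed hG⟩, fun V _ G _ hG => ?_⟩
  have hReed : ∀ (W : Type u) [Fintype W] (H : SimpleGraph W) [DecidableRel H.Adj],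
      H.maxDegree ≤ 4 → SatisfiesReed H := fun _ _ _ _ => satisfiesReed_of_maxDegree_le_four
  rcases hG with hG | hG
  · exact satisfiesReed_of_isIndepSet hReed hG
  · refine satisfiesReed_of_induced_odd_cycle hReed fun n hn hodd C => ?_
    obtain ⟨i, hi⟩ := hG n hn hodd C
    exact ⟨i, Nat.succ_le_succ hi⟩
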